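/- For a non-constant polynomial $P$ and an interval $I=[a,c]$ with $a<c$, put $\|P\|^*_I=\sup_{x\in I}|P(x)|^{1/\deg P}$, and let the monic integer transfinite diameter of $I$ be $t_{\mathrm M}(I)=\inf_P\|P\|^*_I$, the infimum being over all non-constant monic polynomials $P$ with integer coefficients. For $b>0$ write $t_{\mathrm M}(b)=t_{\mathrm M}([0,b])$, and for an integer $n\ge 1$ let $\delta_n$ be the supremum of all $\delta\ge 0$ such that $t_{\mathrm M}\left(\tfrac1n+\varepsilon\right)=\tfrac1n$ for all $0\le\varepsilon\le\delta$. Then (a) $t_{\mathrm M}(b)=\tfrac14$ for all $b\in[\tfrac14,\,0.303]$; (b) $t_{\mathrm M}(b)=\tfrac13$ for all $b\in[\tfrac13,\,0.465]$; (c) $t_{\mathrm M}(b)=\tfrac12$ for all $b\in[\tfrac12,\,1.26]$; (d) $t_{\mathrm M}(1.328)>\tfrac12$. Moreover $0.76\le\delta_2<0.828$, $\delta_3>0.132$ and $\delta_4>0.053$. -/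

import Mathlib

noncomputable section

/-- The normalized supremum `sup_{x ∈ I} |P(x)| ^ (1 / deg P)` of an integer polynomial `P`
on a set `I` of reals. -/
def normalizedSup (P : Polynomial ℤ) (I : Set ℝ) : ℝ :=
  ⨆ x : I, |Polynomial.aeval (x : ℝ) P| ^ (1 / (P.natDegree : ℝ))

/-- The monic integer transfinite diameter of `I`: the infimum of the normalized suprema on `I` of
all non-constant monic polynomials with integer coefficients. -/
def monicTransfiniteDiameter (I : Set ℝ) : ℝ :=
  ⨅ P : {P : Polynomial ℤ // P.Monic ∧ 0 < P.natDegree}, normalizedSup P I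

/-- `tM b` is the monic integer transfinite diameter of the interval `[0, b]`. -/
def tM (b : ℝ) : ℝ :=
  monicTransfiniteDiameter (Set.Icc 0 b)

/-- `stableLength n` is the supremum of all `δ ≥ 0` such that the monic integer transfinite diameter
of `[0, 1/n + ε]` equals `1/n` for every `ε ∈ [0, δ]`. -/
def stableLength (n : ℕ) : ℝ :=
  sSup {δ : ℝ | 0 ≤ δ ∧ ∀ ε ∈ Set.Icc (0 : ℝ) δ, tM (1 / (n : ℝ) + ε) = 1 / (n : ℝ)}

end

open Polynomial

/-! Lower bounds come from resultants. Suppose `Q` has all its roots in `[0, b]` and reduces modulo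
a prime to a nonzero constant. Then its resultant with any monic integer `P` is a nonzero integer,
so `1 ≤ |lc Q| ^ deg P * ∏ |P β|` over the roots `β` of `Q`, whence `‖P‖* ≥ |lc Q| ^ (-1 / deg Q)`
(`one_le_of_map_eq_C`). Taking `Q = n X - 1` gives `1 / n`; taking `Q = 7 X³ - 14 X² + 7 X - 1`
gives `7 ^ (-1/3) ≈ 0.523 > 1/2`.

Upper bounds come from one explicit monic `P` of degree `d` for each `n = 2, 3, 4`, with `n ^ d * |P
x| ≤ 1` on the interval. In `y = n x` the value `1` is attained at the interior point `y = 1`, so `1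
- n ^ d * P` has a double zero there. Once `(1 - y) ^ 2` is divided out, nonnegativity is certified
by Bernstein coefficients on subintervals (`abs_aeval_le_of_chebyshevTest`). Polynomials are
coefficient lists so that the kernel can evaluate the certificates. -/

/-- The value at `y` of the polynomial with the given coefficients, constant term first. -/
def listEval (l : List ℤ) (y : ℝ) : ℝ :=
  l.foldr (fun c v => (c : ℝ) + y * v) 0

/-- The integer polynomial with the given coefficients, constant term first. -/
noncomputable def listPoly (l : List ℤ) : ℤ[X] :=
  l.foldr (fun c p => C c + X * p) 0

@[simp] lemma listEval_nil (y : ℝ) : listEval [] y = 0 := rfl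

@[simp] lemma listEval_cons (c : ℤ) (l : List ℤ) (y : ℝ) :
    listEval (c :: l) y = c + y * listEval l y := rfl

@[simp] lemma listPoly_nil : listPoly [] = 0 := rfl

@[simp] lemma listPoly_cons (c : ℤ) (l : List ℤ) :
    listPoly (c :: l) = C c + X * listPoly l := rfl

lemma aeval_listPoly (l : List ℤ) (y : ℝ) : aeval y (listPoly l) = listEval l y := by
  induction l with
  | nil => simp
  | cons c l ih => simp [ih]

lemma listPoly_concat_one_eq (l : List ℤ) :
    listPoly (l ++ [1]) = X ^ l.length + listPoly l := by
  induction l with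
  | nil => simp
  | cons c l ih =>
    simp only [List.cons_append, listPoly_cons, ih, List.length_cons]
    ring

lemma degree_listPoly_lt (l : List ℤ) : (listPoly l).degree < l.length := by
  induction l with
  | nil => simp
  | cons c l ih =>
    rw [degree_lt_iff_coeff_zero] at ih ⊢
    intro m hm
    rcases m with _ | m
    · simp at hm
    · simp only [listPoly_cons, coeff_add, coeff_C_succ, coeff_X_mul, zero_add]
      exact ih m (by simpa using hm)

lemma monic_listPoly_concat_one (l : List ℤ) : (listPoly (l ++ [1])).Monic := by
  rw [listPoly_concat_one_eq]
  exact monic_X_pow_add (degree_listPoly_lt l)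

lemma natDegree_listPoly_concat_one (l : List ℤ) :
    (listPoly (l ++ [1])).natDegree = l.length := by
  rw [listPoly_concat_one_eq, add_comm]
  refine natDegree_eq_of_degree_eq_some ?_
  rw [degree_add_eq_right_of_degree_lt] <;> rw [degree_X_pow]
  exact degree_listPoly_lt l

/-! ### Scaling and division by `1 - y` on coefficient lists -/

/-- Coefficients of `n ^ d * P (y / n)` as a polynomial in `y`, for `P` of formal degree `d`. -/
def scaleList (n : ℤ) : List ℤ → List ℤ
  | [] => []
  | c :: l => c * n ^ l.length :: scaleList n l

lemma listEval_scaleList (n : ℤ) (l : List ℤ) (x : ℝ) :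
    n * listEval (scaleList n l) (n * x) = n ^ l.length * listEval l x := by
  induction l with
  | nil => simp [scaleList]
  | cons c l ih =>
    simp only [scaleList, listEval_cons, List.length_cons, Int.cast_mul, Int.cast_pow]
    linear_combination (n * x : ℝ) * ih

/-- The running sums of a list, started at `s`. -/
def partialSums : ℤ → List ℤ → List ℤ
  | _, [] => []
  | s, c :: l => (s + c) :: partialSums (s + c) l

/-- Power series division by `1 - y`: it is exact when the total coefficient sum, the value at `y =
1` for `s = 0`, vanishes. -/
lemma listEval_partialSums (s : ℤ) (l : List ℤ) (y : ℝ) :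
    (1 - y) * listEval (partialSums s l) y =
      s + listEval l y - y ^ l.length * ((s + l.sum : ℤ) : ℝ) := by
  induction l generalizing s with
  | nil => simp [partialSums]
  | cons c l ih =>
    have h := ih (s + c)
    simp only [partialSums, listEval_cons, List.length_cons, List.sum_cons]
    push_cast at h ⊢
    linear_combination y * h

/-- Add a constant to a polynomial given by its coefficients. -/
def addConst (a : ℤ) : List ℤ → List ℤ
  | [] => [a]
  | c :: l => (a + c) :: l

lemma listEval_addConst (a : ℤ) (l : List ℤ) (y : ℝ) :
    listEval (addConst a l) y = a + listEval l y := by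
  cases l <;> simp [addConst, add_assoc]

lemma listEval_map_neg (l : List ℤ) (y : ℝ) :
    listEval (l.map (fun c => -c)) y = -listEval l y := by
  induction l with
  | nil => simp
  | cons c l ih =>
    simp only [List.map_cons, listEval_cons, ih]
    push_cast
    ring

/-! ### Bernstein nonnegativity certificates -/

/-- Coefficientwise sum of two polynomials. -/
def addList : List ℤ → List ℤ → List ℤ
  | [], m => m
  | l, [] => l
  | a :: l, b :: m => (a + b) :: addList l m

lemma listEval_addList (l m : List ℤ) (y : ℝ) :
    listEval (addList l m) y = listEval l y + listEval m y := by
  induction l generalizing m with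
  | nil => simp [addList]
  | cons a l ih =>
    cases m with
    | nil => simp [addList]
    | cons b m =>
      simp only [addList, listEval_cons, ih]
      push_cast
      ring

/-- Multiply a polynomial by `a + c * t`. -/
def mulLinear (a c : ℤ) (l : List ℤ) : List ℤ :=
  addList (l.map (fun z => a * z)) (0 :: l.map (fun z => c * z))

lemma listEval_map_mul (a : ℤ) (l : List ℤ) (y : ℝ) :
    listEval (l.map (fun z => a * z)) y = a * listEval l y := by
  induction l with
  | nil => simp
  | cons c l ih =>
    simp only [List.map_cons, listEval_cons, ih]
    push_cast
    ring

lemma listEval_mulLinear (a c : ℤ) (l : List ℤ) (t : ℝ) :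
    listEval (mulLinear a c l) t = (a + c * t) * listEval l t := by
  simp only [mulLinear, listEval_addList, listEval_map_mul, listEval_cons]
  push_cast
  ring

/-- Numerator and (shifted) denominator of the pullback of a polynomial of formal degree `d` under
`t ↦ (a + c * t) / (e * (1 + t))`: the second component is `(e * (1 + t)) ^ (d + 1)`. -/
def moebius (a c e : ℤ) : List ℤ → List ℤ × List ℤ
  | [] => ([], [1])
  | q :: l =>
    let r := moebius a c e l
    (addList (r.2.map (fun z => q * z)) (mulLinear a c r.1), mulLinear e e r.2)

lemma listEval_moebius_snd (a c e : ℤ) (l : List ℤ) (t : ℝ) :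
    listEval (moebius a c e l).2 t = (e + e * t) ^ l.length := by
  induction l with
  | nil => simp [moebius]
  | cons q l ih =>
    simp only [moebius, listEval_mulLinear, ih, List.length_cons]
    ring

lemma listEval_moebius_fst (a c e : ℤ) (l : List ℤ) (t y : ℝ)
    (hy : (e + e * t) * y = a + c * t) :
    (e + e * t) * listEval (moebius a c e l).1 t = (e + e * t) ^ l.length * listEval l y := by
  induction l with
  | nil => simp [moebius]
  | cons q l ih =>
    simp only [moebius, listEval_addList, listEval_map_mul, listEval_mulLinear,
      listEval_moebius_snd, listEval_cons, List.length_cons]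
    rw [mul_add, mul_left_comm, mul_left_comm _ (_ + _) (listEval _ _), ih, ← hy]
    ring

lemma listEval_nonneg {l : List ℤ} (hl : l.all (fun c => decide (0 ≤ c)) = true) {t : ℝ}
    (ht : 0 ≤ t) : 0 ≤ listEval l t := by
  induction l with
  | nil => simp
  | cons c l ih =>
    simp only [List.all_cons, Bool.and_eq_true, decide_eq_true_eq] at hl
    have h1 : (0 : ℝ) ≤ c := by exact_mod_cast hl.1
    have h2 := ih hl.2
    rw [listEval_cons]
    positivity

lemma listEval_nonneg_of_moebius {l : List ℤ} {a c e : ℤ} (he : 0 < e)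
    (hl : (moebius a c e l).1.all (fun z => decide (0 ≤ z)) = true) {y : ℝ}
    (h1 : (a : ℝ) ≤ e * y) (h2 : e * y < c) : 0 ≤ listEval l y := by
  have he' : (0 : ℝ) < e := by exact_mod_cast he
  have hd : 0 < (c : ℝ) - e * y := by linarith
  -- Inverse of the Möbius map carrying `[0, ∞)` onto `[a/e, c/e)`; the endpoint `c/e` corresponds
  -- to `t = ∞`, hence the strict `h2`.
  set t : ℝ := (e * y - a) / (c - e * y) with ht
  have ht0 : 0 ≤ t := div_nonneg (by linarith) hd.le
  have htd : t * (c - e * y) = e * y - a := div_mul_cancel₀ _ hd.ne'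
  have hv : 0 < (e : ℝ) + e * t := by positivity
  have h := listEval_moebius_fst a c e l t y (by linear_combination -htd)
  have h3 := listEval_nonneg hl ht0
  have h4 : 0 ≤ ((e : ℝ) + e * t) ^ l.length * listEval l y := by
    rw [← h]
    positivity
  exact nonneg_of_mul_nonneg_right h4 (by positivity)

/-- The polynomial `l` passes the Bernstein nonnegativity test on each of the intervals cut out by
the points `a :: m`, all divided by `e`. -/
def bernsteinTest (l : List ℤ) (e a : ℤ) : List ℤ → Bool
  | [] => true
  | c :: m => (moebius a c e l).1.all (fun z => decide (0 ≤ z)) && bernsteinTest l e c m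

lemma listEval_nonneg_of_bernsteinTest {l : List ℤ} {e : ℤ} (he : 0 < e) {m : List ℤ} {a : ℤ}
    (h : bernsteinTest l e a m = true) {y : ℝ} (h1 : (a : ℝ) ≤ e * y)
    (h2 : e * y < ((m.getLastD a : ℤ) : ℝ)) : 0 ≤ listEval l y := by
  induction m generalizing a with
  | nil => exact absurd h2 (not_lt.mpr (by simpa using h1))
  | cons c m ih =>
    simp only [bernsteinTest, Bool.and_eq_true] at h
    rcases lt_or_ge ((e : ℝ) * y) c with hc | hc
    · exact listEval_nonneg_of_moebius he h.1 h1 hc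
    · refine ih h.2 hc ?_
      rwa [List.getLastD_cons] at h2

/-- A test which certifies that the monic polynomial `P` with lower coefficients `l` satisfies
`n ^ deg P * |P x| ≤ 1` whenever `0 ≤ e * n * x < m.getLastD 0`. The polynomial `1 - n ^ d * P` is
divided by `(1 - n * x) ^ 2` first. -/
def chebyshevTest (n e : ℤ) (m l : List ℤ) : Bool :=
  let N := scaleList n (l ++ [1])
  let A := addConst 1 (N.map (fun c => -c))
  let B := partialSums 0 A
  decide (A.sum = 0) && decide (B.sum = 0) && bernsteinTest (partialSums 0 B) e 0 m &&
    bernsteinTest (addConst 1 N) e 0 m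

lemma abs_aeval_le_of_chebyshevTest {n e : ℤ} (hn : 0 < n) (he : 0 < e) {m l : List ℤ}
    (h : chebyshevTest n e m l = true) {x : ℝ} (h0 : 0 ≤ x)
    (h1 : (e : ℝ) * (n * x) < ((m.getLastD 0 : ℤ) : ℝ)) :
    |aeval x (listPoly (l ++ [1]))| ≤ (1 / (n : ℝ)) ^ l.length := by
  simp only [chebyshevTest, Bool.and_eq_true, decide_eq_true_eq] at h
  obtain ⟨⟨⟨hA, hB⟩, hR⟩, hP⟩ := h
  have hn' : (0 : ℝ) < n := by exact_mod_cast hn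
  have he' : (0 : ℝ) < e := by exact_mod_cast he
  have hy : ((0 : ℤ) : ℝ) ≤ e * (n * x) := by
    push_cast
    positivity
  have hR' := listEval_nonneg_of_bernsteinTest he hR hy h1
  have hP' := listEval_nonneg_of_bernsteinTest he hP hy h1
  have e1 := listEval_partialSums 0 (addConst 1 ((scaleList n (l ++ [1])).map (fun c => -c)))
    (n * x)
  have e2 := listEval_partialSums 0
    (partialSums 0 (addConst 1 ((scaleList n (l ++ [1])).map (fun c => -c)))) (n * x)
  rw [hA] at e1
  rw [hB] at e2
  have e3 := listEval_scaleList n (l ++ [1]) x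
  rw [listEval_addConst, listEval_map_neg] at e1
  rw [listEval_addConst] at hP'
  rw [aeval_listPoly]
  simp only [List.length_append, List.length_singleton, pow_succ] at e3
  have e4 : listEval (scaleList n (l ++ [1])) (n * x) =
      (n : ℝ) ^ l.length * listEval (l ++ [1]) x := by
    apply mul_left_cancel₀ hn'.ne'
    linear_combination e3
  push_cast at e1 e2 hP'
  rw [e4] at e1 hP'
  have h5 : 0 ≤ 1 - (n : ℝ) ^ l.length * listEval (l ++ [1]) x := by
    have : 1 - (n : ℝ) ^ l.length * listEval (l ++ [1]) x = (1 - n * x) ^ 2 *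
      listEval (partialSums 0 (partialSums 0
        (addConst 1 ((scaleList n (l ++ [1])).map (fun c => -c))))) (n * x) := by
      linear_combination -e1 - (1 - n * x) * e2
    rw [this]
    positivity
  have hpos : 0 < (n : ℝ) ^ l.length := pow_pos hn' _
  have h6 : |(n : ℝ) ^ l.length * listEval (l ++ [1]) x| ≤ 1 :=
    abs_le.mpr ⟨by linarith, by linarith⟩
  rwa [abs_mul, abs_of_pos hpos, ← le_div_iff₀' hpos, ← one_div_pow] at h6

/-! ### The monic integer transfinite diameter -/

/-- An unbounded real supremum would take the default value `0`, so boundedness is needed before any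
value can be compared with it. -/
lemma bddAbove_normalizedSup (P : ℤ[X]) (b : ℝ) : BddAbove (Set.range fun x : Set.Icc (0 : ℝ) b =>
    |aeval (x : ℝ) P| ^ (1 / (P.natDegree : ℝ))) := by
  have hc : ContinuousOn (fun x : ℝ => |aeval x P| ^ (1 / (P.natDegree : ℝ))) (Set.Icc 0 b) := by
    apply ContinuousOn.rpow_const
    · exact (Polynomial.continuous_aeval P).abs.continuousOn
    · intro x _
      right
      positivity
  have := (isCompact_Icc.image_of_continuousOn hc).bddAbove
  rwa [Set.image_eq_range] at this

lemma normalizedSup_nonneg (P : ℤ[X]) (I : Set ℝ) : 0 ≤ normalizedSup P I :=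
  Real.iSup_nonneg fun _ => by positivity

lemma abs_aeval_le_normalizedSup_pow {P : ℤ[X]} (hP : 0 < P.natDegree) {b x : ℝ}
    (hx : x ∈ Set.Icc 0 b) : |aeval x P| ≤ normalizedSup P (Set.Icc 0 b) ^ P.natDegree := by
  have h : |aeval x P| ^ (1 / (P.natDegree : ℝ)) ≤ normalizedSup P (Set.Icc 0 b) :=
    le_ciSup (bddAbove_normalizedSup P b) (⟨x, hx⟩ : Set.Icc (0 : ℝ) b)
  calc |aeval x P| = (|aeval x P| ^ (1 / (P.natDegree : ℝ))) ^ P.natDegree := by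
        rw [one_div, Real.rpow_inv_natCast_pow (abs_nonneg _) hP.ne']
    _ ≤ _ := by gcongr

lemma bddBelow_normalizedSup (I : Set ℝ) : BddBelow (Set.range
    fun P : {P : ℤ[X] // P.Monic ∧ 0 < P.natDegree} => normalizedSup P I) :=
  ⟨0, by rintro _ ⟨P, rfl⟩; exact normalizedSup_nonneg _ _⟩

lemma le_tM {b r : ℝ} (h : ∀ P : ℤ[X], P.Monic → 0 < P.natDegree →
    r ≤ normalizedSup P (Set.Icc 0 b)) : r ≤ tM b := by
  have : Nonempty {P : ℤ[X] // P.Monic ∧ 0 < P.natDegree} := ⟨X, monic_X, by simp⟩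
  exact le_ciInf fun P => h P P.2.1 P.2.2

lemma tM_le {b r : ℝ} (hb : 0 ≤ b) (hr : 0 ≤ r) {P : ℤ[X]} (hP : P.Monic) (hd : 0 < P.natDegree)
    (h : ∀ x ∈ Set.Icc 0 b, |aeval x P| ≤ r ^ P.natDegree) : tM b ≤ r := by
  refine (ciInf_le (bddBelow_normalizedSup _)
    (⟨P, hP, hd⟩ : {P : ℤ[X] // P.Monic ∧ 0 < P.natDegree})).trans ?_
  have : Nonempty (Set.Icc (0 : ℝ) b) := ⟨⟨0, le_rfl, hb⟩⟩
  refine ciSup_le fun x => ?_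
  calc |aeval (x : ℝ) P| ^ (1 / (P.natDegree : ℝ))
      ≤ (r ^ P.natDegree) ^ (1 / (P.natDegree : ℝ)) := by
        gcongr
        exact h x x.2
    _ = r := by rw [one_div, Real.pow_rpow_inv_natCast hr hd.ne']

/-! ### Lower bounds from resultants -/

/-- If `Q` splits over the reals and `P` has nonzero resultant with it, then `P` cannot be small at
all the roots of `Q`. -/
lemma one_le_of_resultant_ne_zero {P Q : ℤ[X]} (hQ : (Q.map (Int.castRingHom ℝ)).Splits)
    (hres : resultant Q P ≠ 0) {M : ℝ}
    (hM : ∀ β ∈ (Q.map (Int.castRingHom ℝ)).roots, |aeval β P| ≤ M) :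
    1 ≤ |(Q.leadingCoeff : ℝ)| ^ P.natDegree * M ^ Q.natDegree := by
  have hinj : Function.Injective (Int.castRingHom ℝ) := (Int.castRingHom ℝ).injective_int
  have h1 := resultant_eq_prod_eval (Q.map (Int.castRingHom ℝ)) (P.map (Int.castRingHom ℝ))
    P.natDegree natDegree_map_le hQ
  rw [natDegree_map_eq_of_injective hinj, resultant_map_map,
    leadingCoeff_map_of_injective hinj] at h1
  have h2 : (1 : ℝ) ≤ |((resultant Q P : ℤ) : ℝ)| := by
    exact_mod_cast Int.one_le_abs hres
  have hcard : Multiset.card (Q.map (Int.castRingHom ℝ)).roots = Q.natDegree := by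
    rw [← hQ.natDegree_eq_card_roots, natDegree_map_eq_of_injective hinj]
  have h3 : |((Q.map (Int.castRingHom ℝ)).roots.map
      (P.map (Int.castRingHom ℝ)).eval).prod| ≤ M ^ Q.natDegree := by
    rw [← hcard]
    generalize (Q.map (Int.castRingHom ℝ)).roots = s at hM
    induction s using Multiset.induction with
    | empty => simp
    | cons a s ih =>
      rw [Multiset.map_cons, Multiset.prod_cons, Multiset.card_cons, abs_mul, pow_succ']
      have ha : |eval a (P.map (Int.castRingHom ℝ))| ≤ M := by
        simpa [aeval_def, eval_map] using hM a (Multiset.mem_cons_self a s)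
      exact mul_le_mul ha (ih fun β hβ => hM β (Multiset.mem_cons_of_mem hβ)) (abs_nonneg _)
        ((abs_nonneg _).trans ha)
  calc (1 : ℝ) ≤ |((resultant Q P : ℤ) : ℝ)| := h2
    _ = |(Q.leadingCoeff : ℝ)| ^ P.natDegree * |((Q.map (Int.castRingHom ℝ)).roots.map
      (P.map (Int.castRingHom ℝ)).eval).prod| := by
        rw [← abs_pow, ← abs_mul]
        exact congrArg abs h1
    _ ≤ _ := by gcongr

/-- A lower bound for the transfinite diameter from a polynomial which reduces to a nonzero
constant modulo a prime. -/
lemma one_le_of_map_eq_C {Q : ℤ[X]} {p : ℕ} [Fact p.Prime] {u : ZMod p} (hu : u ≠ 0)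
    (hQu : Q.map (Int.castRingHom (ZMod p)) = C u)
    (hQ : (Q.map (Int.castRingHom ℝ)).Splits) {b : ℝ}
    (hroots : ∀ β ∈ (Q.map (Int.castRingHom ℝ)).roots, β ∈ Set.Icc 0 b)
    {P : ℤ[X]} (hP : P.Monic) (hd : 0 < P.natDegree) :
    1 ≤ |(Q.leadingCoeff : ℝ)| * normalizedSup P (Set.Icc 0 b) ^ Q.natDegree := by
  have hres : resultant Q P ≠ 0 := by
    intro h0
    -- `P` is monic, so the resultant modulo `p`, at the same formal degrees, is up to sign a power
    -- of `u`.
    have h := resultant_map_map Q P Q.natDegree P.natDegree (Int.castRingHom (ZMod p))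
    rw [h0, hQu, resultant_C_left, coeff_map, coeff_natDegree, hP.leadingCoeff] at h
    simp [hu] at h
  have h := one_le_of_resultant_ne_zero hQ hres
    fun β hβ => abs_aeval_le_normalizedSup_pow hd (hroots β hβ)
  rw [← pow_mul, mul_comm P.natDegree, pow_mul, ← mul_pow] at h
  by_contra! hlt
  have h0 : 0 ≤ |(Q.leadingCoeff : ℝ)| * normalizedSup P (Set.Icc 0 b) ^ Q.natDegree :=
    mul_nonneg (abs_nonneg _) (pow_nonneg (normalizedSup_nonneg _ _) _)
  exact absurd h (not_le.mpr (pow_lt_one₀ h0 hlt hd.ne'))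

/-- `Q = n X - 1` reduces to `-1` modulo any prime factor of `n`. -/
lemma one_div_le_tM {n : ℕ} (hn : 2 ≤ n) {b : ℝ} (hb : 1 / (n : ℝ) ≤ b) : 1 / (n : ℝ) ≤ tM b := by
  have hn0 : (0 : ℝ) < n := by exact_mod_cast (by omega : 0 < n)
  have hnZ : (n : ℤ) ≠ 0 := by exact_mod_cast (by omega : n ≠ 0)
  have hp : Fact n.minFac.Prime := ⟨Nat.minFac_prime (by omega)⟩
  have hmap : (C (n : ℤ) * X + C (-1)).map (Int.castRingHom ℝ) =
      C (n : ℝ) * (X - C (1 / (n : ℝ))) := by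
    simp only [Polynomial.map_add, Polynomial.map_mul, map_C, map_X, mul_sub, ← C_mul,
      mul_one_div_cancel hn0.ne']
    simp [sub_eq_add_neg]
  have hmod : (C (n : ℤ) * X + C (-1)).map (Int.castRingHom (ZMod n.minFac)) =
      C (-1 : ZMod n.minFac) := by
    have : (n : ZMod n.minFac) = 0 :=
      (ZMod.natCast_eq_zero_iff _ _).mpr (Nat.minFac_dvd n)
    simp only [Polynomial.map_add, Polynomial.map_mul, map_C, map_X]
    simp [this]
  have hroots : ∀ β ∈ ((C (n : ℤ) * X + C (-1)).map (Int.castRingHom ℝ)).roots,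
      β ∈ Set.Icc 0 b := by
    intro β hβ
    rw [hmap, roots_C_mul _ hn0.ne', roots_X_sub_C, Multiset.mem_singleton] at hβ
    subst hβ
    exact ⟨by positivity, hb⟩
  refine le_tM fun P hP hd => ?_
  have h := one_le_of_map_eq_C (neg_ne_zero.mpr one_ne_zero) hmod
    (by rw [hmap]; exact (Splits.C _).mul (Splits.X_sub_C _)) hroots hP hd
  rw [natDegree_linear hnZ, leadingCoeff_linear hnZ, pow_one, Int.cast_natCast,
    abs_of_pos hn0] at h
  rwa [div_le_iff₀' hn0]

/-- The cubic `7 X³ - 14 X² + 7 X - 1` has three real roots, all in `[0, 1.32799]`. -/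
lemma exists_roots_cubic : ∃ β₁ β₂ β₃ : ℝ, β₁ ∈ Set.Icc (0 : ℝ) 0.3 ∧ β₂ ∈ Set.Icc (0.35 : ℝ) 0.5 ∧
    β₃ ∈ Set.Icc (1.3 : ℝ) 1.32799 ∧
    (C 7 * X ^ 3 + C (-14) * X ^ 2 + C 7 * X + C (-1) : ℝ[X]) =
      C 7 * ((X - C β₁) * ((X - C β₂) * (X - C β₃))) := by
  have hf : Continuous fun x : ℝ => 7 * x ^ 3 - 14 * x ^ 2 + 7 * x - 1 := by fun_prop
  obtain ⟨β₁, h₁, e₁⟩ := intermediate_value_Icc (show (0 : ℝ) ≤ 0.3 by norm_num) hf.continuousOn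
    (show (0 : ℝ) ∈ _ by constructor <;> norm_num)
  obtain ⟨β₂, h₂, e₂⟩ := intermediate_value_Icc' (show (0.35 : ℝ) ≤ 0.5 by norm_num)
    hf.continuousOn (show (0 : ℝ) ∈ _ by constructor <;> norm_num)
  obtain ⟨β₃, h₃, e₃⟩ := intermediate_value_Icc (show (1.3 : ℝ) ≤ 1.32799 by norm_num)
    hf.continuousOn (show (0 : ℝ) ∈ _ by constructor <;> norm_num)
  refine ⟨β₁, β₂, β₃, h₁, h₂, h₃, ?_⟩
  dsimp only at e₁ e₂ e₃
  have n₁₂ : β₂ - β₁ ≠ 0 := by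
    have := h₁.2
    have := h₂.1
    intro h
    linarith
  have n₁₃ : β₃ - β₁ ≠ 0 := by
    have := h₁.2
    have := h₃.1
    intro h
    linarith
  have n₂₃ : β₃ - β₂ ≠ 0 := by
    have := h₂.2
    have := h₃.1
    intro h
    linarith
  -- Divided differences at the distinct roots yield Vieta's relations.
  have d₁₂ : 7 * (β₁ ^ 2 + β₁ * β₂ + β₂ ^ 2) - 14 * (β₁ + β₂) + 7 = 0 := by
    apply mul_left_cancel₀ n₁₂
    linear_combination e₂ - e₁
  have d₁₃ : 7 * (β₁ ^ 2 + β₁ * β₃ + β₃ ^ 2) - 14 * (β₁ + β₃) + 7 = 0 := by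
    apply mul_left_cancel₀ n₁₃
    linear_combination e₃ - e₁
  have s₁ : β₃ = 2 - β₁ - β₂ := by
    apply mul_left_cancel₀ n₂₃
    linear_combination (d₁₃ - d₁₂) / 7
  have s₂ : β₁ * β₂ + β₁ * β₃ + β₂ * β₃ = 1 := by
    rw [s₁]
    linear_combination -d₁₂ / 7
  have s₃ : 7 * (β₁ * β₂ * β₃) = 1 := by
    rw [s₁] at s₂ ⊢
    linear_combination e₁ + 7 * β₁ * s₂
  have c₁ := congrArg C s₁
  have c₂ := congrArg C s₂
  have c₃ := congrArg C s₃
  simp only [map_sub, map_add, map_mul, map_one, map_neg] at c₁ c₂ c₃ ⊢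
  have h2 : (C (2 : ℝ)) = 2 := rfl
  have h7 : (C (7 : ℝ)) = 7 := rfl
  have h14 : (C (14 : ℝ)) = 14 := rfl
  rw [h7] at c₃ ⊢
  rw [h14]
  rw [h2] at c₁
  linear_combination (7 * X ^ 2) * c₁ - 7 * X * c₂ + c₃

lemma half_lt_tM {b : ℝ} (hb : 1.32799 ≤ b) : 1 / 2 < tM b := by
  have h7 : (Int.castRingHom (ZMod 7)) 7 = 0 := by decide
  have h14 : (Int.castRingHom (ZMod 7)) (-14) = 0 := by decide
  have hp : Fact (Nat.Prime 7) := ⟨by norm_num⟩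
  obtain ⟨β₁, β₂, β₃, h₁, h₂, h₃, hQ⟩ := exists_roots_cubic
  have hmap : (C 7 * X ^ 3 + C (-14) * X ^ 2 + C 7 * X + C (-1) : ℤ[X]).map
      (Int.castRingHom ℝ) = C 7 * ((X - C β₁) * ((X - C β₂) * (X - C β₃))) := by
    rw [← hQ]
    simp only [Polynomial.map_add, Polynomial.map_mul, Polynomial.map_pow, Polynomial.map_C, map_X]
    norm_num only [eq_intCast]
  have hmod : (C 7 * X ^ 3 + C (-14) * X ^ 2 + C 7 * X + C (-1) : ℤ[X]).map
      (Int.castRingHom (ZMod 7)) = C (-1 : ZMod 7) := by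
    simp only [Polynomial.map_add, Polynomial.map_mul, Polynomial.map_pow, map_C, map_X, h7, h14]
    simp
  have hne : (X - C β₁) * ((X - C β₂) * (X - C β₃)) ≠ 0 :=
    mul_ne_zero (X_sub_C_ne_zero _) (mul_ne_zero (X_sub_C_ne_zero _) (X_sub_C_ne_zero _))
  have hroots : ∀ β ∈ ((C 7 * X ^ 3 + C (-14) * X ^ 2 + C 7 * X + C (-1) : ℤ[X]).map
      (Int.castRingHom ℝ)).roots, β ∈ Set.Icc 0 b := by
    intro β hβ
    rw [hmap, roots_C_mul _ (by norm_num), roots_mul hne, roots_mul (right_ne_zero_of_mul hne),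
      roots_X_sub_C, roots_X_sub_C, roots_X_sub_C] at hβ
    simp only [Multiset.mem_add, Multiset.mem_singleton] at hβ
    obtain ⟨l₁, u₁⟩ := h₁
    obtain ⟨l₂, u₂⟩ := h₂
    obtain ⟨l₃, u₃⟩ := h₃
    rcases hβ with rfl | rfl | rfl <;> constructor <;> linarith
  -- An infimum preserves only weak inequalities, so a fixed number between `1/2` and `7 ^ (-1/3)`
  -- is used.
  have hlow : (0.51 : ℝ) ≤ tM b := by
    refine le_tM fun P hP hd => ?_
    have h := one_le_of_map_eq_C (neg_ne_zero.mpr one_ne_zero) hmod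
      (by rw [hmap]; exact (Splits.C _).mul ((Splits.X_sub_C _).mul
        ((Splits.X_sub_C _).mul (Splits.X_sub_C _)))) hroots hP hd
    rw [natDegree_cubic (by norm_num), leadingCoeff_cubic (by norm_num)] at h
    by_contra! hlt
    have h3 : normalizedSup P (Set.Icc 0 b) ^ 3 < 0.51 ^ 3 :=
      pow_lt_pow_left₀ hlt (normalizedSup_nonneg _ _) (by norm_num)
    norm_num at h h3
    linarith
  linarith

/-! ### Extremal polynomials -/

/-- Lower coefficients of a monic polynomial of degree 40, extremal beyond `[0, 1/2]`. -/
def extremalTwo : List ℤ :=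
  [0, 0, 0, 0, 0, 0, 0, 0, 0, 0, 0, 0, 0, -1, 31, -458, 4296, -28750, 146235, -587994, 1918983,
   -5178679, 11712360, -22417340, 36565861, -51074052, 61267286, -63198180, 56037270,
   -42627279, 27714863, -15312594, 7130530, -2766830, 880671, -224962, 44691, -6585, 666, -40]

/-- The cut points over `2000` subdivide `[0, 2 * 1.261]` dyadically in `y = 2 x`; the end exceeds
`2 * 1.26` because the test is half-open. -/
lemma chebyshevTest_extremalTwo :
    chebyshevTest 2 2000
    [0, 1261, 2522, 5044] extremalTwo = true := by
  decide +kernel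

/-- Lower coefficients of a monic polynomial of degree 36, extremal beyond `[0, 1/3]`. -/
def extremalThree : List ℤ :=
  [0, 0, 0, 0, 0, 0, 0, 0, 0, 0, 0, 0, 0, 0, -4, 296, -10244, 220676, -3321509, 37159534,
   -320842041, 2190649753, -12019855597, 53550335093, -194868898010, 580493736472,
   -1413674597468, 2800274384299, -4469401026338, 5661268562347, -5559535861755, 4080712476372,
   -2106831717921, 682490944963, -104439215675, 48720849]

lemma chebyshevTest_extremalThree :
    chebyshevTest 3 800000
    [0, 279204, 558408, 698010, 837612, 977214, 1047015, 1116816] extremalThree = true := by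
  decide +kernel

/-- Lower coefficients of a monic polynomial of degree 32, extremal beyond `[0, 1/4]`. -/
def extremalFour : List ℤ :=
  [0, 0, 0, 0, 0, 0, 0, 0, 0, 0, 0, 0, 0, 0, 0, 0, 0, 0, 0, 0, 0, 0, -6, 230, -3855, 37172,
   -227679, 919997, -2455420, 4178035, -4116054, 1789992]

lemma chebyshevTest_extremalFour :
    chebyshevTest 4 100000
    [0, 60602, 90903, 121204] extremalFour = true := by
  decide +kernel

lemma tM_eq_of_chebyshevTest {n : ℕ} (hn : 2 ≤ n) {e : ℤ} (he : 0 < e) {m l : List ℤ}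
    (hl : l ≠ []) (h : chebyshevTest n e m l = true) {b : ℝ} (hb : 1 / (n : ℝ) ≤ b)
    (hb' : e * (n * b) < ((m.getLastD 0 : ℤ) : ℝ)) : tM b = 1 / (n : ℝ) := by
  have hn0 : (0 : ℝ) < n := by exact_mod_cast (by omega : 0 < n)
  have he0 : (0 : ℝ) < e := by exact_mod_cast he
  refine le_antisymm ?_ (one_div_le_tM hn hb)
  refine tM_le ((by positivity : 0 ≤ 1 / (n : ℝ)).trans hb) (by positivity)
    (monic_listPoly_concat_one l) ?_ fun x hx => ?_
  · rw [natDegree_listPoly_concat_one]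
    exact List.length_pos_iff.mpr hl
  · rw [natDegree_listPoly_concat_one]
    have h2 : (e : ℝ) * (n * x) ≤ e * (n * b) := by
      have := hx.2
      gcongr
    have := abs_aeval_le_of_chebyshevTest (n := n) (by omega) he h hx.1
      (by rw [Int.cast_natCast]; linarith)
    simpa using this

/-! ### Bounds for the stable lengths -/

/-- The failure at `c` bounds the set above; without it `sSup` would default to `0`. -/
lemma le_stableLength {n : ℕ} {δ c : ℝ} (hδ : 0 ≤ δ) (hc : tM (1 / (n : ℝ) + c) ≠ 1 / (n : ℝ))
    (hc0 : 0 ≤ c) (h : ∀ b : ℝ, 1 / (n : ℝ) ≤ b → b ≤ 1 / (n : ℝ) + δ → tM b = 1 / (n : ℝ)) :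
    δ ≤ stableLength n := by
  refine le_csSup ⟨c, ?_⟩ ⟨hδ, fun ε hε => h _ (by linarith [hε.1]) (by linarith [hε.2])⟩
  rintro η ⟨-, hη⟩
  by_contra! hlt
  exact hc (hη c ⟨hc0, hlt.le⟩)

lemma stableLength_le {n : ℕ} {c : ℝ} (hc0 : 0 ≤ c)
    (hc : tM (1 / (n : ℝ) + c) ≠ 1 / (n : ℝ)) : stableLength n ≤ c := by
  refine Real.sSup_le ?_ hc0
  rintro η ⟨-, hη⟩
  by_contra! hlt
  exact hc (hη c ⟨hc0, hlt.le⟩)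

lemma tM_eq_half {b : ℝ} (h : 1 / 2 ≤ b) (h' : b ≤ 1.26) : tM b = 1 / 2 := by
  have := tM_eq_of_chebyshevTest (n := 2) le_rfl (by norm_num) (by decide) chebyshevTest_extremalTwo
    (b := b) (by exact_mod_cast h)
    (by simp only [List.getLastD]; norm_num at h' ⊢; linarith)
  exact_mod_cast this

lemma tM_eq_third {b : ℝ} (h : 1 / 3 ≤ b) (h' : b ≤ 0.465339) : tM b = 1 / 3 := by
  have := tM_eq_of_chebyshevTest (n := 3) (by norm_num) (by norm_num) (by decide)
    chebyshevTest_extremalThree (b := b) (by exact_mod_cast h)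
    (by simp only [List.getLastD]; norm_num at h' ⊢; linarith)
  exact_mod_cast this

lemma tM_eq_fourth {b : ℝ} (h : 1 / 4 ≤ b) (h' : b ≤ 0.303005) : tM b = 1 / 4 := by
  have := tM_eq_of_chebyshevTest (n := 4) (by norm_num) (by norm_num) (by decide)
    chebyshevTest_extremalFour (b := b) (by exact_mod_cast h)
    (by simp only [List.getLastD]; norm_num at h' ⊢; linarith)
  exact_mod_cast this

theorem theorem8p3 :
    (∀ b ∈ Set.Icc (1 / 4 : ℝ) 0.303, tM b = 1 / 4) ∧
    (∀ b ∈ Set.Icc (1 / 3 : ℝ) 0.465, tM b = 1 / 3) ∧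
    (∀ b ∈ Set.Icc (1 / 2 : ℝ) 1.26, tM b = 1 / 2) ∧
    1 / 2 < tM 1.328 ∧
    (0.76 ≤ stableLength 2 ∧ stableLength 2 < 0.828) ∧
    0.132 < stableLength 3 ∧
    0.053 < stableLength 4 := by
  -- `1/2 + 0.82799 = 1.32799` still lies above the largest root of the cubic, which makes
  -- `stableLength 2 < 0.828` strict.
  have hhalf : tM (1 / ((2 : ℕ) : ℝ) + 0.82799) ≠ 1 / ((2 : ℕ) : ℝ) := by
    have h := half_lt_tM (b := 1 / ((2 : ℕ) : ℝ) + 0.82799) (by norm_num)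
    exact fun he => absurd h (by rw [he]; norm_num)
  have hlarge : (1 / 2 : ℝ) < tM 2 := half_lt_tM (by norm_num)
  refine ⟨fun b hb => tM_eq_fourth hb.1 (hb.2.trans (by norm_num)),
    fun b hb => tM_eq_third hb.1 (hb.2.trans (by norm_num)),
    fun b hb => tM_eq_half hb.1 hb.2, half_lt_tM (by norm_num), ⟨?_, ?_⟩, ?_, ?_⟩
  · refine le_stableLength (by norm_num) hhalf (by norm_num) fun b h h' => ?_
    exact_mod_cast tM_eq_half (by exact_mod_cast h) (h'.trans (by norm_num))
  · exact (stableLength_le (by norm_num) hhalf).trans_lt (by norm_num)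
  -- The certificate reaches past `0.465`: `0.465 - 1/3 < 0.132`, while `1/3 + 0.132005 < 0.465339`.
  -- The witness `5/3` is chosen so that `1/3 + 5/3 = 2`.
  · refine lt_of_lt_of_le (by norm_num : (0.132 : ℝ) < 0.132005)
      (le_stableLength (c := 5 / 3) (by norm_num) ?_ (by norm_num) fun b h h' => ?_)
    · norm_num at hlarge ⊢
      exact fun he => by rw [he] at hlarge; norm_num at hlarge
    · exact_mod_cast tM_eq_third (by exact_mod_cast h) (h'.trans (by norm_num))
  · refine lt_of_lt_of_le (by norm_num : (0.053 : ℝ) < 0.053005)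
      (le_stableLength (c := 7 / 4) (by norm_num) ?_ (by norm_num) fun b h h' => ?_)
    · norm_num at hlarge ⊢
      exact fun he => by rw [he] at hlarge; norm_num at hlarge
    · exact_mod_cast tM_eq_fourth (by exact_mod_cast h) (h'.trans (by norm_num))
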